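/- For a symmetric probability measure $\phi$ on a group $G$ (that is, $\phi(g^{-1})=\phi(g)$) set $\mathcal E_\phi(f,f)=\frac12\sum_{x,y\in G}(f(xy)-f(x))^2\phi(y)$ for $f:G\to\mathbb R$, and for $v>0$, $s>0$ $$\Lambda_{G,\phi}(v)=\inf\{\mathcal E_\phi(f,f):\ |\mathrm{support}(f)|\le v,\ \|f\|_2=1\},\qquad \Lambda^{-1}_{G,\phi}(s)=\inf\{v>0:\Lambda_{G,\phi}(v)\le s\},$$ with $\inf\emptyset=+\infty$; in particular $\Lambda_{G,\phi}(v)=+\infty$ for $v<1$, $\Lambda_{G,\phi}(1)=1-\phi(e)$ and $\Lambda^{-1}_{G,\phi}(s)\in[1,\infty]$. Powers of elements of $[1,\infty]$ with exponent $\infty$ are $1^\infty=1$ and $a^\infty=\infty$ for $a>1$. The wreath product $H_1\wr H_2$ is the group of pairs $(\eta,x)$ with $x\in H_2$ and $\eta:H_2\to H_1$ of finite support (equal to $e$ off a finite set), with product $(\eta,x)(\eta',x')=(\eta\cdot\eta'(x^{-1}\,\cdot),xx')$. The group $H_1$ is embedded as the lamp group over $e\in H_2$, by $h\mapsto(\eta_h,e)$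 with $\eta_h(e)=h$ and $\eta_h=e$ elsewhere, and $H_2$ is embedded by $x\mapsto(e,x)$. There is a universal constant $K>0$ such that for all finitely generated groups $H_1,H_2$ and all symmetric probability measures $\mu_{H_1}$ on $H_1$ and $\mu_{H_2}$ on $H_2$, the switch-or-walk measure $q=\frac12(\mu_{H_1}+\mu_{H_2})$ on $H_1\wr H_2$ (with $\mu_{H_1},\mu_{H_2}$ carried to $H_1\wr H_2$ by the embeddings) satisfies the following. For all $v>0$ and all $0<s\le\max\{\Lambda_{H_1,\mu_{H_1}}(1),\Lambda_{H_2,\mu_{H_2}}(1)\}$, $$\Lambda_{H_1\wr H_2,q}(v)\ge \frac sK\quad\text{whenever}\quad v\le \Lambda^{-1}_{H_1,\mu_{H_1}}(s)^{\,\Lambda^{-1}_{H_2,\mu_{H_2}}(s)/K}.$$ In the other direction, for all $s,v>0$, $$\Lambda_{H_1\wr H_2,q}(v)\le s\quad\text{whenever}\quad v\ge \Lambda^{-1}_{H_1,\mu_{H_1}}(s)^{\,\Lambda^{-1}_{H_2,\mu_{H_2}}(s)}\,\Lambda^{-1}_{H_2,\mu_{H_2}}(s).$$ -/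

import Mathlib

open scoped ENNReal NNReal

noncomputable section

namespace WreathProfile

/-- The Dirichlet form `E_φ(f,f) = (1/2) ∑_{x,y} (f(xy) - f(x))² φ(y)`, as a sum of nonnegative
terms with values in `[0,∞]`. -/
def dirichletForm {G : Type*} [Group G] (φ : PMF G) (f : G → ℝ) : ℝ≥0∞ :=
  (∑' x : G, ∑' y : G, ENNReal.ofReal ((f (x * y) - f x) ^ 2) * φ y) / 2

/-- The lowest Dirichlet eigenvalue `λ_φ(Ω) = inf {E_φ(f,f) : support f ⊆ Ω, ‖f‖₂ = 1}`.
It is `∞` (infimum of the empty set) for `Ω = ∅`. -/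
def dirichletEigenvalue {G : Type*} [Group G] (φ : PMF G) (Ω : Finset G) : ℝ≥0∞ :=
  ⨅ (f : G → ℝ) (_ : Function.support f ⊆ (Ω : Set G))
    (_ : ∑' x : G, ENNReal.ofReal ((f x) ^ 2) = 1), dirichletForm φ f

/-- The `L²`-isoperimetric (spectral) profile `Λ_φ(v) = inf {λ_φ(Ω) : |Ω| ≤ v}`. -/
def spectralProfile {G : Type*} [Group G] (φ : PMF G) (v : ℝ≥0) : ℝ≥0∞ :=
  ⨅ (Ω : Finset G) (_ : (Ω.card : ℝ≥0) ≤ v), dirichletEigenvalue φ Ω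

/-- The right-continuous inverse `Λ_φ⁻¹(s) = inf {v : Λ_φ(v) ≤ s}` of the nonincreasing
function `Λ_φ`, equal to `∞` when no such `v` exists. -/
def spectralProfileInv {G : Type*} [Group G] (φ : PMF G) (s : ℝ≥0) : ℝ≥0∞ :=
  ⨅ (v : ℝ≥0) (_ : spectralProfile φ v ≤ (s : ℝ≥0∞)), (v : ℝ≥0∞)

/-- The power `a ^ b` for `a, b ∈ [0,∞]`: the usual real power for finite `b`, and for `b = ∞`
the limit of `a ^ t` as `t → ∞`. -/
def extPow (a b : ℝ≥0∞) : ℝ≥0∞ :=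
  if b = ∞ then (if a < 1 then 0 else if a = 1 then 1 else ∞) else a ^ b.toReal

/-- The (restricted) wreath product `L ≀ B` with lamp group `L` and base group `B`: pairs `(η, x)`
of a finitely supported `η : B → L` and `x ∈ B`, with product
`(η, x)(η', x') = (η · η'(x⁻¹ ·), x x')`. -/
def wreathProduct (L B : Type*) [Group L] [Group B] : Subgroup (RegularWreathProduct L B) where
  carrier := {a | (Function.mulSupport a.left).Finite}
  one_mem' := by simp
  mul_mem' := by
    intro a b ha hb
    have hb' : (Function.mulSupport fun x => b.left (a.right⁻¹ * x)).Finite :=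
      hb.preimage (mul_right_injective a.right⁻¹).injOn
    exact (ha.union hb').subset (Function.mulSupport_mul _ _)
  inv_mem' := by
    intro a ha
    have ha' : (Function.mulSupport fun x => (a.left (a.right * x))).Finite :=
      ha.preimage (mul_right_injective a.right).injOn
    refine ha'.subset ?_
    intro x hx
    simpa using hx

open Classical in
/-- The embedding of the lamp group: `ℓ ↦ (η, e)` with `η(e) = ℓ` and `η = e` elsewhere. -/
def lampHom (L B : Type*) [Group L] [Group B] : L →* wreathProduct L B where
  toFun l := ⟨⟨Pi.mulSingle 1 l, 1⟩,
    (Set.finite_singleton (1 : B)).subset Pi.mulSupport_mulSingle_subset⟩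
  map_one' := by
    apply Subtype.ext
    ext <;> simp
  map_mul' a b := by
    apply Subtype.ext
    ext <;> simp [Pi.mulSingle_mul]

/-- The embedding of the base group: `x ↦ (e, x)`. -/
def baseHom (L B : Type*) [Group L] [Group B] : B →* wreathProduct L B where
  toFun x := ⟨⟨1, x⟩, show (Function.mulSupport (1 : B → L)).Finite by simp⟩
  map_one' := by
    apply Subtype.ext
    ext <;> simp
  map_mul' a b := by
    apply Subtype.ext
    ext <;> simp

/-- The mixture `(p + q) / 2` of two probability measures. -/
def halfSum {G : Type*} (p q : PMF G) : PMF G :=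
  ⟨fun g => (p g + q g) / 2, by
    have h : ∑' g, (p g + q g) / 2 = 1 := by
      simp only [div_eq_mul_inv]
      rw [ENNReal.tsum_mul_right, ENNReal.tsum_add, p.tsum_coe, q.tsum_coe, one_add_one_eq_two]
      exact ENNReal.mul_inv_cancel two_ne_zero ENNReal.ofNat_ne_top
    exact h ▸ ENNReal.summable.hasSum⟩

/-- The switch-or-walk measure `(μ_L + μ_B) / 2` on `L ≀ B`, where `μ_L` and `μ_B` are pushed
forward by the two embeddings. -/
def switchOrWalk {L B : Type*} [Group L] [Group B] (μL : PMF L) (μB : PMF B) :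
    PMF (wreathProduct L B) :=
  halfSum (μL.map (lampHom L B)) (μB.map (baseHom L B))

/-- A probability measure `φ` on a group is symmetric if `φ(g⁻¹) = φ(g)` for all `g`. -/
def IsSymmetricPMF {G : Type*} [Group G] (φ : PMF G) : Prop := ∀ g : G, φ g⁻¹ = φ g

end WreathProfile

end

open WreathProfile

universe u w

/-!
The constant is `K = 2500`. Write `n₁`, `n₂` for the inverse profiles of the lamp group and of the
base group at `s`; a finite value is an integer at which the infimum is attained.

Both halves rest on one remark. A measure carried by the image of an injective homomorphism `ι`
only moves points inside left cosets of that image, so its Dirichlet form is the sum over the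
cosets of the Dirichlet forms of the restrictions (`dirichletForm_map`).

*Upper bound.* Multiply nearly optimal functions: `f (η, x) = (∏ y ∈ Ω₂, f₁ (η y)) * f₂ x`, for
configurations `η` that are trivial off `Ω₂`. On each lamp coset this is a multiple of a translate
of `f₁` and on each base coset a multiple of a translate of `f₂`, so its Rayleigh quotient is the
mean of the two energies, while its support has at most `n₁ ^ n₂ * n₂` points.

*Lower bound.* The profile of the wreath product is at least half of each factor's profile, which
settles the cases in which `n₁` or `n₂` is infinite or `n₁ = 1`. Otherwise let `f` be normalised
with energy below `s / K`. By Markov's inequality almost all the mass of `f ^ 2` lies on points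
whose lamp coset and base coset both have a small Rayleigh quotient. On such a coset the mass is
spread out: a subset carrying a definite share of it has more than `n₁ / 2`, respectively
`n₂ / 20`, points (`sum_sq_le_of_dirichletForm_le`). Deleting cosets that have lost too much of
their mass, organised as the maximisation of a potential (`exists_pruned`), leaves a nonempty set
`S` in the support of `f` that holds such a share of every coset it meets. Each configuration
occurring in `S` then has more than `n₂ / 20` directions in which it can be changed, within the
configurations of `S`, to more than `n₁ / 2` values, and an induction on the number of directions
(`pow_le_card_of_directions`) gives `|S| ≥ (n₁ / 2 + 1) ^ (n₂ / 20 + 1)`, with integer divisions.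
This exceeds `n₁ ^ (n₂ / K)`.
-/

namespace WreathProfile

/-! ### The Dirichlet form and the Rayleigh quotient -/

/-- The squared `ℓ²`-norm `‖f‖₂²`, with values in `[0,∞]`. -/
noncomputable def sqNorm {α : Type*} (f : α → ℝ) : ℝ≥0∞ := ∑' x, ENNReal.ofReal (f x ^ 2)

lemma sqNorm_eq_sum {α : Type*} {f : α → ℝ} {A : Finset α}
    (hA : Function.support f ⊆ (A : Set α)) :
    sqNorm f = ENNReal.ofReal (∑ x ∈ A, f x ^ 2) := by
  rw [sqNorm, ENNReal.ofReal_sum_of_nonneg (fun _ _ => sq_nonneg _), tsum_eq_sum]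
  intro x hx
  have : f x = 0 := by
    by_contra h
    exact hx (hA h)
  simp [this]

lemma sqNorm_const_mul {α : Type*} (c : ℝ) (f : α → ℝ) :
    sqNorm (fun x => c * f x) = ENNReal.ofReal (c ^ 2) * sqNorm f := by
  simp only [sqNorm, mul_pow, ENNReal.ofReal_mul (sq_nonneg c), ENNReal.tsum_mul_left]

lemma sqNorm_ne_zero {α : Type*} {f : α → ℝ} {x : α} (hx : f x ≠ 0) : sqNorm f ≠ 0 := by
  rw [sqNorm, Ne, ENNReal.tsum_eq_zero]
  intro h
  have := ENNReal.ofReal_eq_zero.1 (h x)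
  exact absurd this (not_le.2 (by positivity))

variable {G : Type*} [Group G]

lemma dirichletForm_const_mul (φ : PMF G) (c : ℝ) (f : G → ℝ) :
    dirichletForm φ (fun x => c * f x) = ENNReal.ofReal (c ^ 2) * dirichletForm φ f := by
  simp only [dirichletForm, ← mul_sub, mul_pow, ENNReal.ofReal_mul (sq_nonneg c), mul_assoc,
    ENNReal.tsum_mul_left, mul_div_assoc]

lemma dirichletForm_comp_mul_left (φ : PMF G) (b : G) (f : G → ℝ) :
    dirichletForm φ (fun x => f (b * x)) = dirichletForm φ f := by
  unfold dirichletForm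
  congr 1
  simpa [mul_assoc] using (Equiv.mulLeft b).tsum_eq
    (fun x => ∑' y : G, ENNReal.ofReal ((f (x * y) - f x) ^ 2) * φ y)

lemma sqNorm_comp_mul_left (b : G) (f : G → ℝ) : sqNorm (fun x => f (b * x)) = sqNorm f :=
  (Equiv.mulLeft b).tsum_eq (fun x => ENNReal.ofReal (f x ^ 2))

lemma dirichletForm_le_of_contraction (φ : PMF G) {f g : G → ℝ}
    (h : ∀ x y, |g x - g y| ≤ |f x - f y|) : dirichletForm φ g ≤ dirichletForm φ f := by
  unfold dirichletForm
  gcongr ?_ / 2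
  refine ENNReal.tsum_le_tsum fun x => ENNReal.tsum_le_tsum fun y => ?_
  gcongr ?_ * _
  exact ENNReal.ofReal_le_ofReal (sq_le_sq.2 (h _ _))

/-- The variational characterisation of the spectral profile, without normalisation of `f`. -/
lemma spectralProfile_mul_sqNorm_le (φ : PMF G) {f : G → ℝ} {Ω : Finset G} {v : ℝ≥0}
    (hf : Function.support f ⊆ (Ω : Set G)) (hΩ : (Ω.card : ℝ≥0) ≤ v) :
    spectralProfile φ v * sqNorm f ≤ dirichletForm φ f := by
  set N : ℝ := ∑ x ∈ Ω, f x ^ 2 with hN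
  have hsq : sqNorm f = ENNReal.ofReal N := sqNorm_eq_sum hf
  have hN0 : 0 ≤ N := Finset.sum_nonneg fun _ _ => sq_nonneg _
  rcases hN0.eq_or_lt with h0 | hpos
  · simp [hsq, ← h0]
  have hc2 : ((√N)⁻¹) ^ 2 = N⁻¹ := by rw [inv_pow, Real.sq_sqrt hN0]
  have hc : ENNReal.ofReal (((√N)⁻¹) ^ 2) = (ENNReal.ofReal N)⁻¹ := by
    rw [hc2, ENNReal.ofReal_inv_of_pos hpos]
  have hNt : ENNReal.ofReal N ≠ 0 := by simpa using hpos
  have key : spectralProfile φ v ≤ dirichletForm φ (fun x => (√N)⁻¹ * f x) := by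
    refine iInf₂_le_of_le Ω hΩ (iInf₂_le_of_le (fun x => (√N)⁻¹ * f x) ?_ (iInf_le _ ?_))
    · intro x hx
      exact hf (right_ne_zero_of_mul hx)
    · change sqNorm (fun x => (√N)⁻¹ * f x) = 1
      rw [sqNorm_const_mul, hc, hsq, ENNReal.inv_mul_cancel hNt ENNReal.ofReal_ne_top]
  rw [dirichletForm_const_mul, hc, ← hsq] at key
  calc spectralProfile φ v * sqNorm f
      ≤ ((sqNorm f)⁻¹ * dirichletForm φ f) * sqNorm f := by gcongr
    _ = dirichletForm φ f := by
      rw [mul_right_comm, ENNReal.inv_mul_cancel (hsq ▸ hNt) (hsq ▸ ENNReal.ofReal_ne_top), one_mul]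

/-! ### The spectral profile and its inverse -/

lemma spectralProfile_antitone (φ : PMF G) : Antitone (spectralProfile φ) := fun _ _ hab =>
  le_iInf₂ fun Ω hΩ => iInf₂_le Ω (hΩ.trans hab)

lemma spectralProfile_floor_le (φ : PMF G) (v : ℝ≥0) :
    spectralProfile φ (⌊v⌋₊ : ℝ≥0) ≤ spectralProfile φ v :=
  le_iInf₂ fun Ω hΩ => iInf₂_le Ω (by exact_mod_cast Nat.le_floor hΩ)

lemma spectralProfile_zero (φ : PMF G) : spectralProfile φ 0 = ∞ := by
  refine iInf₂_eq_top.2 fun Ω hΩ => ?_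
  have hΩ' : Ω = ∅ := by simpa using hΩ
  subst hΩ'
  refine iInf₂_eq_top.2 fun f hf => iInf_eq_top.2 fun h => ?_
  have : f = 0 := by simpa using hf
  simp [this] at h

lemma lt_spectralProfile_of_inv_eq_top {φ : PMF G} {s : ℝ≥0} (h : spectralProfileInv φ s = ∞)
    (v : ℝ≥0) : (s : ℝ≥0∞) < spectralProfile φ v := by
  by_contra! hv
  exact ENNReal.coe_ne_top (iInf₂_eq_top.1 h v hv)

/-- A finite value of the inverse profile is a positive integer, and the infimum is attained. -/
lemma exists_nat_eq_spectralProfileInv {φ : PMF G} {s : ℝ≥0} (h : spectralProfileInv φ s ≠ ∞) :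
    ∃ n : ℕ, 1 ≤ n ∧ spectralProfileInv φ s = n ∧ spectralProfile φ n ≤ s ∧
      ∀ k : ℕ, k < n → (s : ℝ≥0∞) < spectralProfile φ k := by
  classical
  have hex : ∃ k : ℕ, spectralProfile φ k ≤ s := by
    by_contra! hk
    exact h (iInf₂_eq_top.2 fun v hv =>
      absurd ((spectralProfile_floor_le φ v).trans hv) (not_le.2 (hk _)))
  refine ⟨Nat.find hex, ?_, le_antisymm ?_ ?_, Nat.find_spec hex,
    fun k hk => not_le.1 (Nat.find_min hex hk)⟩
  · rw [Nat.one_le_iff_ne_zero]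
    intro h0
    have := Nat.find_spec hex
    simp [h0, spectralProfile_zero] at this
  · exact iInf₂_le_of_le _ (Nat.find_spec hex) (by simp)
  · refine le_iInf₂ fun v hv => ?_
    have h1 := Nat.find_min' hex ((spectralProfile_floor_le φ v).trans hv)
    have h2 : ((Nat.find hex : ℕ) : ℝ≥0) ≤ v :=
      (Nat.cast_le.2 h1).trans (Nat.floor_le v.2)
    exact_mod_cast ENNReal.coe_le_coe.2 h2

/-! ### Functions of small energy are spread out -/

/-- If the profile exceeds `s` below volume `n` and the energy of `f` is at most `ε s ‖f‖₂²`,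
then `f²` is spread out: a set of `k` points carries little more than the fraction `k / n` of the
mass. The reason is that the part of `|f|` above the level `t = ‖f‖₂ / √n` lives on fewer than
`n` points, so the spectral gap forces it to have norm at most `√ε ‖f‖₂`. -/
theorem sum_sq_le_of_dirichletForm_le {φ : PMF G} {s ε : ℝ≥0} (hs : 0 < s) {n : ℕ} (hn : 1 ≤ n)
    (gap : ∀ k : ℕ, k < n → (s : ℝ≥0∞) < spectralProfile φ k) {f : G → ℝ} {A : Finset G}
    (hA : Function.support f ⊆ (A : Set G)) (hE : dirichletForm φ f ≤ ε * s * sqNorm f)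
    {U : Finset G} (hU : U ⊆ A) {θ : ℝ} (hθ : 0 < θ) :
    ∑ x ∈ U, f x ^ 2 ≤
      ((1 + θ) * (U.card / n) + (1 + θ⁻¹) * ε) * ∑ x ∈ A, f x ^ 2 := by
  classical
  set N : ℝ := ∑ x ∈ A, f x ^ 2 with hN
  have hN0 : 0 ≤ N := Finset.sum_nonneg fun _ _ => sq_nonneg _
  have hn' : (0 : ℝ) < n := by exact_mod_cast hn
  set t : ℝ := √(N / n) with ht
  have ht0 : 0 ≤ t := Real.sqrt_nonneg _
  have ht2 : t ^ 2 = N / n := Real.sq_sqrt (by positivity)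
  set g : G → ℝ := fun x => max (|f x| - t) 0 with hg
  set B : Finset G := A.filter fun x => t < |f x| with hB
  have hgB : Function.support g ⊆ (B : Set G) := by
    intro x hx
    have hx' : t < |f x| := by
      by_contra! h
      exact hx (max_eq_right (by linarith))
    have : f x ≠ 0 := by
      intro h0
      rw [h0, abs_zero] at hx'
      linarith
    simp only [hB, Finset.coe_filter, Set.mem_ofPred_eq]
    exact ⟨hA this, hx'⟩
  have hcard : B.card < n := by
    rcases B.eq_empty_or_nonempty with h | h
    · rw [h, Finset.card_empty]; omega
    have h1 : B.card • t ^ 2 < ∑ x ∈ B, f x ^ 2 := by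
      rw [← Finset.sum_const]
      refine Finset.sum_lt_sum_of_nonempty h fun x hx => ?_
      rw [← sq_abs (f x)]
      have := (Finset.mem_filter.1 hx).2
      gcongr
    have h2 : ∑ x ∈ B, f x ^ 2 ≤ N :=
      Finset.sum_le_sum_of_subset_of_nonneg (Finset.filter_subset _ _) fun _ _ _ => sq_nonneg _
    have h3 : (B.card : ℝ) * (N / n) < N := by
      rw [nsmul_eq_mul, ht2] at h1
      exact h1.trans_le h2
    have hNpos : 0 < N := lt_of_le_of_lt (by positivity) h3
    rw [← mul_div_assoc, div_lt_iff₀ hn', mul_comm N] at h3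
    exact_mod_cast lt_of_mul_lt_mul_right h3 hN0
  have hgA : Function.support g ⊆ (A : Set G) :=
    hgB.trans (by exact_mod_cast Finset.filter_subset _ _)
  have hgE : dirichletForm φ g ≤ dirichletForm φ f := by
    refine dirichletForm_le_of_contraction φ fun x y => ?_
    refine (abs_max_sub_max_le_abs _ _ _).trans ?_
    rw [sub_sub_sub_cancel_right]
    exact abs_abs_sub_abs_le_abs_sub _ _
  have hs' : (s : ℝ≥0∞) ≠ 0 := by exact_mod_cast hs.ne'
  have hgN : ∑ x ∈ A, g x ^ 2 ≤ ε * N := by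
    have h1 : (s : ℝ≥0∞) * sqNorm g ≤ s * (ε * sqNorm f) :=
      calc (s : ℝ≥0∞) * sqNorm g ≤ spectralProfile φ (B.card : ℝ≥0) * sqNorm g := by
            gcongr; exact (gap _ hcard).le
        _ ≤ dirichletForm φ g := spectralProfile_mul_sqNorm_le φ hgB le_rfl
        _ ≤ ε * s * sqNorm f := hgE.trans hE
        _ = s * (ε * sqNorm f) := by ring
    rw [ENNReal.mul_le_mul_iff_right hs' ENNReal.coe_ne_top, sqNorm_eq_sum hgA, sqNorm_eq_sum hA,
      ← ENNReal.ofReal_coe_nnreal, ← ENNReal.ofReal_mul ε.coe_nonneg] at h1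
    exact (ENNReal.ofReal_le_ofReal_iff (by positivity)).1 h1
  -- `|f| ≤ t + g`, and `2 t g ≤ θ t ^ 2 + θ⁻¹ g ^ 2`
  have hpt : ∀ x, f x ^ 2 ≤ (1 + θ) * t ^ 2 + (1 + θ⁻¹) * g x ^ 2 := by
    intro x
    have h1 : |f x| ≤ t + g x := by
      have : |f x| - t ≤ g x := le_max_left _ _
      linarith
    have h2 : f x ^ 2 ≤ (t + g x) ^ 2 := by
      rw [← sq_abs (f x)]
      gcongr
    have h3 : 0 ≤ θ⁻¹ * (θ * t - g x) ^ 2 := by positivity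
    have h4 : θ⁻¹ * (θ * t - g x) ^ 2 = θ * t ^ 2 - 2 * t * g x + θ⁻¹ * g x ^ 2 := by
      field_simp
      ring
    nlinarith
  calc ∑ x ∈ U, f x ^ 2 ≤ ∑ x ∈ U, ((1 + θ) * t ^ 2 + (1 + θ⁻¹) * g x ^ 2) :=
        Finset.sum_le_sum fun x _ => hpt x
    _ = U.card * ((1 + θ) * t ^ 2) + (1 + θ⁻¹) * ∑ x ∈ U, g x ^ 2 := by
        rw [Finset.sum_add_distrib, Finset.sum_const, nsmul_eq_mul, Finset.mul_sum]
    _ ≤ U.card * ((1 + θ) * t ^ 2) + (1 + θ⁻¹) * (ε * N) := by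
        gcongr
        exact (Finset.sum_le_sum_of_subset_of_nonneg hU fun _ _ _ => sq_nonneg _).trans hgN
    _ = _ := by rw [ht2]; ring

/-! ### Measures carried by a subgroup and its left cosets -/

section Cosets

variable {H W : Type*} [Group H] [Group W] {ι : H →* W}

/-- The restriction of `f : W → ℝ` to the left coset `c` of the image of `ι`, read on `H` through
the base point `c.out`. -/
noncomputable def cosetRestrict (ι : H →* W) (f : W → ℝ) (c : W ⧸ ι.range) : H → ℝ :=
  fun h => f (c.out * ι h)

lemma mk_out_mul (c : W ⧸ ι.range) (h : H) : ((c.out * ι h : W) : W ⧸ ι.range) = c := by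
  rw [QuotientGroup.mk_mul_of_mem _ (⟨h, rfl⟩ : ι h ∈ ι.range), QuotientGroup.out_eq']

lemma mk_eq_iff_exists {z z' : W} :
    (z' : W ⧸ ι.range) = z ↔ ∃ h, z' = z * ι h := by
  rw [eq_comm, QuotientGroup.eq]
  constructor
  · rintro ⟨h, hh⟩
    exact ⟨h, by rw [hh, mul_inv_cancel_left]⟩
  · rintro ⟨h, rfl⟩
    exact ⟨h, by simp⟩

lemma out_mul_injective (hι : Function.Injective ι) (c : W ⧸ ι.range) :
    Function.Injective fun h => c.out * ι h :=
  (mul_right_injective c.out).comp hι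

lemma exists_eq_out_mul {c : W ⧸ ι.range} {z : W} (h : (z : W ⧸ ι.range) = c) :
    ∃ k, z = c.out * ι k :=
  mk_eq_iff_exists.1 (h.trans (QuotientGroup.out_eq' c).symm)

lemma tsum_eq_tsum_cosets (hι : Function.Injective ι) (g : W → ℝ≥0∞) :
    ∑' z, g z = ∑' c : W ⧸ ι.range, ∑' h, g (c.out * ι h) := by
  have hb : Function.Bijective fun x : (W ⧸ ι.range) × H => x.1.out * ι x.2 := by
    constructor
    · rintro ⟨c, h⟩ ⟨c', h'⟩ e
      have hc : c = c' := by
        rw [← mk_out_mul c h, ← mk_out_mul c' h']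
        exact congrArg _ e
      subst hc
      exact Prod.ext rfl (out_mul_injective hι c e)
    · intro z
      obtain ⟨k, hk⟩ := exists_eq_out_mul (rfl : (z : W ⧸ ι.range) = z)
      exact ⟨(z, k), hk.symm⟩
  rw [← (Equiv.ofBijective _ hb).tsum_eq g, ENNReal.tsum_prod']
  rfl

lemma tsum_mul_map (hι : Function.Injective ι) (μ : PMF H) (F : W → ℝ≥0∞) :
    ∑' y, F y * μ.map ι y = ∑' h, F (ι h) * μ h := by
  have h1 : ∀ h, μ.map ι (ι h) = μ h := fun h => by
    classical
    rw [PMF.map_apply, tsum_eq_single h]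
    · simp
    · intro a ha
      rw [if_neg fun e => ha (hι e.symm)]
  rw [← hι.tsum_eq]
  · simp only [h1]
  · intro y hy
    have : y ∈ (μ.map ι).support := (PMF.mem_support_iff _ _).2 (right_ne_zero_of_mul hy)
    obtain ⟨a, -, rfl⟩ := (PMF.mem_support_map_iff _ _ _).1 this
    exact ⟨a, rfl⟩

lemma dirichletForm_map (hι : Function.Injective ι) (μ : PMF H) (f : W → ℝ) :
    dirichletForm (μ.map ι) f = ∑' c, dirichletForm μ (cosetRestrict ι f c) := by
  simp only [dirichletForm, div_eq_mul_inv, ENNReal.tsum_mul_right, cosetRestrict]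
  congr 1
  simp only [tsum_mul_map hι μ]
  rw [tsum_eq_tsum_cosets hι]
  simp only [map_mul, mul_assoc]

lemma sqNorm_eq_tsum_cosets (hι : Function.Injective ι) (f : W → ℝ) :
    sqNorm f = ∑' c, sqNorm (cosetRestrict ι f c) :=
  tsum_eq_tsum_cosets hι _

lemma dirichletForm_halfSum (p q : PMF W) (f : W → ℝ) :
    dirichletForm (halfSum p q) f = (dirichletForm p f + dirichletForm q f) / 2 := by
  have h : ∀ y, halfSum p q y = (p y + q y) / 2 := fun _ => rfl
  simp only [dirichletForm, h, div_eq_mul_inv, ← mul_assoc, ENNReal.tsum_mul_right, mul_add,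
    ENNReal.tsum_add, add_mul]

open Classical in
/-- The points of `A` in the coset `c`, seen as elements of `H`. -/
noncomputable def cosetSlice (hι : Function.Injective ι) (A : Finset W) (c : W ⧸ ι.range) :
    Finset H :=
  (A.filter fun z : W => (z : W ⧸ ι.range) = c).preimage (fun h => c.out * ι h)
    (out_mul_injective hι c).injOn

open Classical in
lemma sum_cosetSlice {M : Type*} [AddCommMonoid M] (hι : Function.Injective ι) (A : Finset W)
    (c : W ⧸ ι.range) (g : W → M) :
    ∑ h ∈ cosetSlice hι A c, g (c.out * ι h) =
      ∑ z ∈ A.filter (fun z : W => (z : W ⧸ ι.range) = c), g z := by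
  refine Finset.sum_preimage _ _ _ g fun z hz hz' => ?_
  obtain ⟨k, hk⟩ := exists_eq_out_mul (Finset.mem_filter.1 hz).2
  exact absurd ⟨k, hk.symm⟩ hz'

open Classical in
lemma card_cosetSlice (hι : Function.Injective ι) (A : Finset W) (c : W ⧸ ι.range) :
    (cosetSlice hι A c).card = (A.filter fun z : W => (z : W ⧸ ι.range) = c).card := by
  rw [Finset.card_eq_sum_ones, Finset.card_eq_sum_ones]
  exact sum_cosetSlice hι A c fun _ => 1

lemma mem_cosetSlice {hι : Function.Injective ι} {A : Finset W} {c : W ⧸ ι.range} {h : H} :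
    h ∈ cosetSlice hι A c ↔ c.out * ι h ∈ A := by
  simp [cosetSlice, -QuotientGroup.mk_mul_of_mem, mk_out_mul]

lemma support_cosetRestrict_subset (hι : Function.Injective ι) {f : W → ℝ} {A : Finset W}
    (hA : Function.support f ⊆ (A : Set W)) (c : W ⧸ ι.range) :
    Function.support (cosetRestrict ι f c) ⊆ (cosetSlice hι A c : Set H) := fun _ hh =>
  mem_cosetSlice.2 (hA hh)

lemma spectralProfile_mul_sqNorm_le_map (hι : Function.Injective ι) (μ : PMF H) {f : W → ℝ}
    {Ω : Finset W} {v : ℝ≥0} (hf : Function.support f ⊆ (Ω : Set W)) (hΩ : (Ω.card : ℝ≥0) ≤ v) :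
    spectralProfile μ v * sqNorm f ≤ dirichletForm (μ.map ι) f := by
  classical
  rw [dirichletForm_map hι, sqNorm_eq_tsum_cosets hι, ← ENNReal.tsum_mul_left]
  refine ENNReal.tsum_le_tsum fun c =>
    spectralProfile_mul_sqNorm_le μ (support_cosetRestrict_subset hι hf c) (le_trans ?_ hΩ)
  rw [card_cosetSlice]
  exact_mod_cast Finset.card_le_card (Finset.filter_subset _ _)

/-- If `f` restricts on every coset to a multiple of a translate of one normalised function `g`,
then the Rayleigh quotient of `f` is the energy of `g`. -/
lemma dirichletForm_map_of_cosets (hι : Function.Injective ι) (μ : PMF H) {f : W → ℝ} {g : H → ℝ}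
    (hg : sqNorm g = 1) (hf : ∀ z : W, ∃ (a : ℝ) (b : H), ∀ h, f (z * ι h) = a * g (b * h)) :
    dirichletForm (μ.map ι) f = dirichletForm μ g * sqNorm f := by
  rw [dirichletForm_map hι, sqNorm_eq_tsum_cosets hι, ← ENNReal.tsum_mul_left]
  congr 1
  ext c
  obtain ⟨a, b, hab⟩ := hf c.out
  have : cosetRestrict ι f c = fun h => a * g (b * h) := funext hab
  rw [this, dirichletForm_const_mul μ a fun h => g (b * h), sqNorm_const_mul a fun h => g (b * h),
    dirichletForm_comp_mul_left, sqNorm_comp_mul_left, hg, mul_one, mul_comm]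

/-- The cosets on which the Rayleigh quotient of `f` is at most `r`. -/
def lowEnergyCosets (ι : H →* W) (μ : PMF H) (f : W → ℝ) (r : ℝ≥0∞) : Set (W ⧸ ι.range) :=
  {c | dirichletForm μ (cosetRestrict ι f c) ≤ r * sqNorm (cosetRestrict ι f c)}

open Classical in
/-- Markov's inequality for the Rayleigh quotients of `f` on the cosets. -/
lemma mul_sum_sq_not_lowEnergy_le (hι : Function.Injective ι) (μ : PMF H) (f : W → ℝ) (r : ℝ≥0∞)
    (Ω : Finset W) :
    r * ENNReal.ofReal (∑ z ∈ Ω.filter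
      (fun z : W => (z : W ⧸ ι.range) ∉ lowEnergyCosets ι μ f r), f z ^ 2) ≤
      dirichletForm (μ.map ι) f := by
  set L := lowEnergyCosets ι μ f r with hL
  have h1 : ENNReal.ofReal (∑ z ∈ Ω.filter (fun z : W => (z : W ⧸ ι.range) ∉ L), f z ^ 2) ≤
      ∑' z : W, if (z : W ⧸ ι.range) ∉ L then ENNReal.ofReal (f z ^ 2) else 0 := by
    rw [ENNReal.ofReal_sum_of_nonneg fun _ _ => sq_nonneg _, Finset.sum_filter]
    exact ENNReal.sum_le_tsum _
  refine (mul_le_mul_right h1 r).trans ?_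
  rw [tsum_eq_tsum_cosets hι, dirichletForm_map hι, ← ENNReal.tsum_mul_left]
  refine ENNReal.tsum_le_tsum fun c => ?_
  simp only [mk_out_mul]
  by_cases hc : c ∈ L
  · simp [hc]
  · simp only [hc, not_false_eq_true, if_true]
    exact (not_le.1 hc).le

open Classical in
/-- On a coset of low energy, a subset carrying a definite share of the mass of `f²` has many
points. -/
lemma sum_sq_coset_le (hι : Function.Injective ι) {μ : PMF H} {s ε : ℝ≥0} (hs : 0 < s)
    {n : ℕ} (hn : 1 ≤ n) (gap : ∀ k : ℕ, k < n → (s : ℝ≥0∞) < spectralProfile μ k) {f : W → ℝ}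
    {A S : Finset W} (hA : Function.support f ⊆ (A : Set W)) (hS : S ⊆ A) {c : W ⧸ ι.range}
    (hc : c ∈ lowEnergyCosets ι μ f (ε * s)) {θ : ℝ} (hθ : 0 < θ) :
    ∑ z ∈ S.filter (fun z : W => (z : W ⧸ ι.range) = c), f z ^ 2 ≤
      ((1 + θ) * ((S.filter fun z : W => (z : W ⧸ ι.range) = c).card / n) + (1 + θ⁻¹) * ε) *
        ∑ z ∈ A.filter (fun z : W => (z : W ⧸ ι.range) = c), f z ^ 2 := by
  have := sum_sq_le_of_dirichletForm_le hs hn gap (support_cosetRestrict_subset hι hA c) hc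
    (U := cosetSlice hι S c) (fun h hh => mem_cosetSlice.2 (hS (mem_cosetSlice.1 hh))) hθ
  rwa [card_cosetSlice, show ∑ x ∈ cosetSlice hι S c, cosetRestrict ι f c x ^ 2 = _ from
    sum_cosetSlice hι S c fun z => f z ^ 2,
    show ∑ x ∈ cosetSlice hι A c, cosetRestrict ι f c x ^ 2 = _ from
    sum_cosetSlice hι A c fun z => f z ^ 2] at this

open Classical in
/-- On a coset of low energy, a subset carrying at least the fraction `κ` of the mass of `f²` has
at least about `κ n` points. -/
lemma mul_le_card_of_share (hι : Function.Injective ι) {μ : PMF H} {s ε : ℝ≥0} (hs : 0 < s)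
    {n : ℕ} (hn : 1 ≤ n) (gap : ∀ k : ℕ, k < n → (s : ℝ≥0∞) < spectralProfile μ k) {f : W → ℝ}
    {A S : Finset W} (hA : Function.support f ⊆ (A : Set W)) (hS : S ⊆ A) {z₀ : W}
    (hz₀ : f z₀ ≠ 0) (hc : (z₀ : W ⧸ ι.range) ∈ lowEnergyCosets ι μ f (ε * s)) {θ κ : ℝ}
    (hθ : 0 < θ)
    (hκ : κ * ∑ z ∈ A.filter (fun z : W => (z : W ⧸ ι.range) = z₀), f z ^ 2 ≤
      ∑ z ∈ S.filter (fun z : W => (z : W ⧸ ι.range) = z₀), f z ^ 2) :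
    (κ - (1 + θ⁻¹) * ε) * n ≤
      (1 + θ) * (S.filter fun z : W => (z : W ⧸ ι.range) = z₀).card := by
  have hpos : 0 < ∑ z ∈ A.filter (fun z : W => (z : W ⧸ ι.range) = z₀), f z ^ 2 :=
    Finset.sum_pos' (fun _ _ => sq_nonneg _)
      ⟨z₀, Finset.mem_filter.2 ⟨hA hz₀, rfl⟩, sq_pos_of_ne_zero hz₀⟩
  have h1 := le_of_mul_le_mul_right
    (hκ.trans (sum_sq_coset_le hι hs hn gap hA hS hc hθ)) hpos
  have hn' : (0 : ℝ) < n := by exact_mod_cast hn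
  rw [← sub_le_iff_le_add, ← mul_div_assoc, le_div_iff₀ hn'] at h1
  exact h1

end Cosets

/-! ### Two combinatorial lemmas -/

section Pruning

variable {W P L : Type*}

open Classical in
/-- The weight of `S` minus `a` times the weight missing from the `p`-fibres that meet `S` and
`b` times the weight missing from the `l`-fibres that meet `S`. -/
noncomputable def prunePotential (A : Finset W) (m : W → ℝ) (p : W → P) (a : ℝ) (l : W → L) (b : ℝ)
    (S : Finset W) : ℝ :=
  ∑ z ∈ A, m z * (if z ∈ S then 1 else
    -(if p z ∈ S.image p then a else 0) - (if l z ∈ S.image l then b else 0))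

lemma prunePotential_comm (A : Finset W) (m : W → ℝ) (p : W → P) (a : ℝ) (l : W → L) (b : ℝ)
    (S : Finset W) : prunePotential A m p a l b S = prunePotential A m l b p a S := by
  unfold prunePotential
  refine Finset.sum_congr rfl fun z _ => ?_
  congr 2
  ring

open Classical in
/-- A maximiser of the potential holds a definite share of the weight of each `p`-fibre it meets,
since deleting that fibre does not increase the potential. -/
lemma mul_sum_fiber_le_of_maximal {A : Finset W} {m : W → ℝ} (hm : ∀ z, 0 ≤ m z) {p : W → P}
    {l : W → L} {a b : ℝ} (ha : 0 ≤ a) (hb : 0 ≤ b) {S : Finset W} (hS : S ⊆ A)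
    (hmax : ∀ T ⊆ S, prunePotential A m p a l b T ≤ prunePotential A m p a l b S)
    {z₀ : W} (hz₀ : z₀ ∈ S) :
    a * ∑ z ∈ A.filter (fun z => p z = p z₀), m z ≤
      (1 + a + b) * ∑ z ∈ S.filter (fun z => p z = p z₀), m z := by
  set T := S.filter fun z => p z ≠ p z₀ with hT
  have hTS : T ⊆ S := Finset.filter_subset _ _
  -- the change is at least `-1 - b` at a deleted point and `a` at a point of the fibre outside `S`
  have key : ∑ z ∈ A, m z * (if p z = p z₀ then (if z ∈ S then a - (1 + a + b) else a) else 0) ≤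
      prunePotential A m p a l b T - prunePotential A m p a l b S := by
    unfold prunePotential
    rw [← Finset.sum_sub_distrib]
    refine Finset.sum_le_sum fun z _ => ?_
    rw [← mul_sub]
    refine mul_le_mul_of_nonneg_left ?_ (hm z)
    have hl : l z ∈ T.image l → l z ∈ S.image l := fun h => Finset.image_subset_image hTS h
    by_cases hpz : p z = p z₀
    · have h1 : z ∉ T := by simp [hT, hpz]
      have h2 : p z ∉ T.image p := by
        simp only [Finset.mem_image, not_exists, not_and]
        intro y hy he
        exact (Finset.mem_filter.1 hy).2 (he.trans hpz)
      have h3 : p z ∈ S.image p := hpz ▸ Finset.mem_image_of_mem p hz₀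
      simp only [hpz, if_true, h1, if_false]
      rw [hpz] at h2 h3
      simp only [h2, h3, if_false, if_true]
      split_ifs <;> first | linarith | (exfalso; tauto)
    · have h1 : z ∈ T ↔ z ∈ S := by simp [hT, hpz]
      have hp : p z ∈ T.image p → p z ∈ S.image p := fun h => Finset.image_subset_image hTS h
      simp only [hpz, if_false, h1]
      split_ifs <;> first | linarith | (exfalso; tauto)
  have h1 : ∑ z ∈ A, m z * (if p z = p z₀ then (if z ∈ S then a - (1 + a + b) else a) else 0) =
      a * ∑ z ∈ A.filter (fun z => p z = p z₀), m z -
      (1 + a + b) * ∑ z ∈ S.filter (fun z => p z = p z₀), m z := by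
    have h2 : S.filter (fun z => p z = p z₀) =
        (A.filter fun z => p z = p z₀).filter fun z => z ∈ S := by
      ext z
      simp only [Finset.mem_filter]
      have := @hS z
      tauto
    rw [h2, Finset.sum_filter (fun z => z ∈ S), Finset.mul_sum, Finset.mul_sum,
      ← Finset.sum_sub_distrib, Finset.sum_filter]
    refine Finset.sum_congr rfl fun z _ => ?_
    split_ifs <;> ring
  have := hmax T hTS
  linarith

open Classical in
/-- If `G` has nearly full weight in `A`, then some nonempty `S ⊆ G` holds a definite share of the
weight of every fibre of `p` and of `l` that it meets. The shares `1/6` and `2/3` come from the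
penalties `1` and `4` in the potential that `S` maximises. -/
theorem exists_pruned {A G : Finset W} (hG : G ⊆ A) {m : W → ℝ} (hm : ∀ z, 0 ≤ m z) (p : W → P)
    (l : W → L) (hbad : 6 * ∑ z ∈ A \ G, m z < ∑ z ∈ A, m z) :
    ∃ S ⊆ G, S.Nonempty ∧ ∀ z₀ ∈ S,
      ∑ z ∈ A.filter (fun z => p z = p z₀), m z ≤
        6 * ∑ z ∈ S.filter (fun z => p z = p z₀), m z ∧
      2 * ∑ z ∈ A.filter (fun z => l z = l z₀), m z ≤
        3 * ∑ z ∈ S.filter (fun z => l z = l z₀), m z := by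
  obtain ⟨S, hSG, hmax⟩ := Finset.exists_max_image G.powerset (prunePotential A m p 1 l 4)
    ⟨∅, Finset.empty_mem_powerset G⟩
  rw [Finset.mem_powerset] at hSG
  have hmax' : ∀ T ⊆ S, prunePotential A m p 1 l 4 T ≤ prunePotential A m p 1 l 4 S := fun T hT =>
    hmax T (Finset.mem_powerset.2 (hT.trans hSG))
  refine ⟨S, hSG, ?_, fun z₀ hz₀ => ⟨?_, ?_⟩⟩
  · by_contra hS
    rw [Finset.not_nonempty_iff_eq_empty] at hS
    subst hS
    have h0 : prunePotential A m p 1 l 4 ∅ = 0 := by simp [prunePotential]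
    have h1 : ∑ z ∈ A, (m z - if z ∈ A \ G then 6 * m z else 0) ≤
        prunePotential A m p 1 l 4 G := by
      unfold prunePotential
      refine Finset.sum_le_sum fun z hz => ?_
      have := hm z
      by_cases hzG : z ∈ G
      · simp [hzG]
      · simp only [Finset.mem_sdiff, hz, hzG, not_false_eq_true, and_self, if_true, if_false]
        split_ifs <;> linarith
    rw [Finset.sum_sub_distrib, ← Finset.sum_filter, Finset.filter_mem_eq_inter,
      Finset.inter_eq_right.2 Finset.sdiff_subset, ← Finset.mul_sum] at h1
    have h2 := hmax G (Finset.mem_powerset_self G)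
    linarith
  · have := mul_sum_fiber_le_of_maximal (a := 1) (b := 4) hm (by norm_num) (by norm_num)
      (hSG.trans hG) hmax' hz₀
    linarith
  · have := mul_sum_fiber_le_of_maximal (p := l) (l := p) (a := 4) (b := 1) hm (by norm_num)
      (by norm_num) (hSG.trans hG) (fun T hT => by
        rw [prunePotential_comm A m l, prunePotential_comm A m l]; exact hmax' T hT) hz₀
    linarith

end Pruning

open Classical in
/-- A finite set `B` of configurations in which every member has at least `d` directions, each
with at least `m` members of `B` on the line through it, has at least `m ^ d` elements. -/
theorem pow_le_card_of_directions {X L : Type*} (m d : ℕ) (B : Finset (X → L)) (hB : B.Nonempty)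
    (h : ∀ η ∈ B, ∃ D : Finset X, d ≤ D.card ∧ ∀ x ∈ D,
      m ≤ (B.filter fun η' => ∀ y, y ≠ x → η' y = η y).card) : m ^ d ≤ B.card := by
  induction d generalizing B with
  | zero => simpa using hB.card_pos
  | succ d ih =>
    obtain ⟨η₀, hη₀⟩ := hB
    obtain ⟨D, hD, hDm⟩ := h η₀ hη₀
    obtain ⟨x, hx⟩ : D.Nonempty := Finset.card_pos.1 (by omega)
    have hV : m ≤ (B.image fun η => η x).card := by
      refine (hDm x hx).trans (Finset.card_le_card_of_injOn (fun η => η x) ?_ ?_)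
      · intro η hη
        exact Finset.mem_image_of_mem _ (Finset.mem_filter.1 hη).1
      · intro η hη η' hη' he
        have h1 := (Finset.mem_filter.1 hη).2
        have h2 := (Finset.mem_filter.1 hη').2
        funext y
        by_cases hy : y = x
        · exact hy ▸ he
        · rw [h1 y hy, h2 y hy]
    have hslice : ∀ a ∈ B.image fun η => η x, m ^ d ≤ (B.filter fun η => η x = a).card := by
      intro a ha
      obtain ⟨η₁, hη₁, rfl⟩ := Finset.mem_image.1 ha
      refine ih _ ⟨η₁, Finset.mem_filter.2 ⟨hη₁, rfl⟩⟩ fun η hη => ?_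
      obtain ⟨hηB, hηx⟩ := Finset.mem_filter.1 hη
      obtain ⟨D', hD', hDm'⟩ := h η hηB
      refine ⟨D'.erase x, ?_, fun y hy => ?_⟩
      · have := Finset.pred_card_le_card_erase (s := D') (a := x)
        omega
      · refine (hDm' y (Finset.mem_of_mem_erase hy)).trans (Finset.card_le_card fun η' hη' => ?_)
        obtain ⟨h1, h2⟩ := Finset.mem_filter.1 hη'
        refine Finset.mem_filter.2 ⟨Finset.mem_filter.2 ⟨h1, ?_⟩, h2⟩
        -- the line in direction `y ≠ x` does not leave the slice `η x = const`
        rw [h2 x (Finset.ne_of_mem_erase hy).symm, hηx]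
    calc m ^ (d + 1) = m * m ^ d := pow_succ' m d
      _ ≤ (B.image fun η => η x).card * m ^ d := by gcongr
      _ ≤ ∑ a ∈ B.image (fun η => η x), (B.filter fun η => η x = a).card := by
        rw [← smul_eq_mul]
        exact Finset.card_nsmul_le_sum _ _ _ hslice
      _ = B.card := (Finset.card_eq_sum_card_image _ _).symm

/-! ### The wreath product -/

section Wreath

variable {L B : Type*} [Group L] [Group B]

lemma lampHom_injective : Function.Injective (lampHom L B) := by
  classical
  intro a b h
  have h1 : (lampHom L B a).1.left 1 = (lampHom L B b).1.left 1 := by rw [h]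
  simpa [lampHom] using h1

lemma baseHom_injective : Function.Injective (baseHom L B) := by
  intro a b h
  have h1 : (baseHom L B a).1.right = (baseHom L B b).1.right := by rw [h]
  exact h1

lemma mul_lampHom_right (z : wreathProduct L B) (h : L) :
    (z * lampHom L B h).1.right = z.1.right := mul_one z.1.right

lemma mul_lampHom_left_self (z : wreathProduct L B) (h : L) :
    (z * lampHom L B h).1.left z.1.right = z.1.left z.1.right * h := by
  simp [lampHom]

lemma mul_lampHom_left_of_ne (z : wreathProduct L B) (h : L) {y : B} (hy : y ≠ z.1.right) :
    (z * lampHom L B h).1.left y = z.1.left y := by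
  have : z.1.right⁻¹ * y ≠ 1 := fun e => hy (inv_mul_eq_one.1 e).symm
  classical
  simp [lampHom, Pi.mulSingle_eq_of_ne this]

lemma mul_baseHom_right (z : wreathProduct L B) (y : B) :
    (z * baseHom L B y).1.right = z.1.right * y := rfl

lemma mul_baseHom_left (z : wreathProduct L B) (y : B) :
    (z * baseHom L B y).1.left = z.1.left :=
  mul_one z.1.left

lemma wreath_ext {z z' : wreathProduct L B} (hl : z.1.left = z'.1.left)
    (hr : z.1.right = z'.1.right) : z = z' :=
  Subtype.ext (RegularWreathProduct.ext hl hr)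

lemma one_le_spectralProfileInv (φ : PMF L) (s : ℝ≥0) : 1 ≤ spectralProfileInv φ s := by
  by_cases h : spectralProfileInv φ s = ∞
  · simp [h]
  · obtain ⟨n, hn, e, -⟩ := exists_nat_eq_spectralProfileInv h
    rw [e]
    exact_mod_cast hn

/-! ### The upper bound -/

/-- A product test function on the wreath product: the lamps over `Ω₂` contribute the factors
`f₁ (η z)`, the lamps elsewhere are off, and the position contributes `f₂ x`. -/
noncomputable def productFun (Ω₂ : Finset B) (f₁ : L → ℝ) (f₂ : B → ℝ) (z : wreathProduct L B) :
    ℝ := by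
  classical
  exact if ∀ y ∉ Ω₂, z.1.left y = 1 then (∏ y ∈ Ω₂, f₁ (z.1.left y)) * f₂ z.1.right else 0

/-- Off `Ω₂` the function `f₂` vanishes, and a lamp over a point of `Ω₂` enters through a single
factor `f₁`. -/
lemma productFun_lamp_coset {Ω₂ : Finset B} {f₁ : L → ℝ} {f₂ : B → ℝ}
    (hf₂ : Function.support f₂ ⊆ (Ω₂ : Set B)) (z : wreathProduct L B) :
    ∃ (a : ℝ) (b : L), ∀ h, productFun Ω₂ f₁ f₂ (z * lampHom L B h) = a * f₁ (b * h) := by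
  classical
  by_cases hx : z.1.right ∈ Ω₂
  · refine ⟨if ∀ y ∉ Ω₂, z.1.left y = 1 then
      (∏ y ∈ Ω₂.erase z.1.right, f₁ (z.1.left y)) * f₂ z.1.right else 0,
      z.1.left z.1.right, fun h => ?_⟩
    have h1 : (∀ y ∉ Ω₂, (z * lampHom L B h).1.left y = 1) ↔ ∀ y ∉ Ω₂, z.1.left y = 1 := by
      refine forall₂_congr fun y hy => ?_
      rw [mul_lampHom_left_of_ne]
      rintro rfl
      exact hy hx
    rw [productFun, mul_lampHom_right]
    simp only [h1]
    split_ifs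
    · rw [← Finset.mul_prod_erase Ω₂ _ hx, mul_lampHom_left_self,
        Finset.prod_congr rfl fun y hy => by
          rw [mul_lampHom_left_of_ne z h (Finset.ne_of_mem_erase hy)]]
      ring
    · simp
  · refine ⟨0, 1, fun h => ?_⟩
    have : f₂ z.1.right = 0 := by
      by_contra h0
      exact hx (hf₂ h0)
    rw [productFun, mul_lampHom_right, this]
    simp

lemma productFun_base_coset (Ω₂ : Finset B) (f₁ : L → ℝ) (f₂ : B → ℝ) (z : wreathProduct L B) :
    ∃ (a : ℝ) (b : B), ∀ h, productFun Ω₂ f₁ f₂ (z * baseHom L B h) = a * f₂ (b * h) := by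
  classical
  refine ⟨if ∀ y ∉ Ω₂, z.1.left y = 1 then ∏ y ∈ Ω₂, f₁ (z.1.left y) else 0, z.1.right,
    fun h => ?_⟩
  rw [productFun, mul_baseHom_left, mul_baseHom_right]
  split_ifs <;> simp

open Classical in
/-- The group element whose lamps over `Ω₂` are given by `ξ`, all other lamps being off. -/
noncomputable def extendLamps (Ω₂ : Finset B) (ξ : Ω₂ → L) (x : B) : wreathProduct L B :=
  ⟨⟨fun y => if hy : y ∈ Ω₂ then ξ ⟨y, hy⟩ else 1, x⟩,
    Ω₂.finite_toSet.subset fun y hy => by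
      by_contra h
      exact hy (dif_neg h)⟩

/-- The support of a product test function has at most `|Ω₁| ^ |Ω₂| * |Ω₂|` elements. -/
lemma exists_support_productFun {Ω₁ : Finset L} {Ω₂ : Finset B} {f₁ : L → ℝ} {f₂ : B → ℝ}
    (hf₁ : Function.support f₁ ⊆ (Ω₁ : Set L)) (hf₂ : Function.support f₂ ⊆ (Ω₂ : Set B)) :
    ∃ Ω : Finset (wreathProduct L B), Function.support (productFun Ω₂ f₁ f₂) ⊆ (Ω : Set _) ∧
      Ω.card ≤ Ω₁.card ^ Ω₂.card * Ω₂.card := by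
  classical
  refine ⟨((Fintype.piFinset fun _ : Ω₂ => Ω₁) ×ˢ Ω₂).image fun p => extendLamps Ω₂ p.1 p.2,
    fun z hz => ?_, Finset.card_image_le.trans ?_⟩
  · rw [Function.mem_support, productFun, ite_ne_right_iff] at hz
    obtain ⟨h1, h2⟩ := hz
    simp only [Finset.coe_image, Set.mem_image, Finset.mem_coe, Finset.mem_product,
      Fintype.mem_piFinset, Prod.exists]
    refine ⟨fun y => z.1.left y, z.1.right, ⟨fun y => hf₁ ?_, hf₂ (right_ne_zero_of_mul h2)⟩, ?_⟩
    · exact Finset.prod_ne_zero_iff.1 (left_ne_zero_of_mul h2) y y.2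
    · refine wreath_ext (funext fun y => ?_) rfl
      by_cases hy : y ∈ Ω₂
      · simp [extendLamps, hy]
      · simp [extendLamps, hy, h1 y hy]
  · simp

lemma productFun_extendLamps_const (Ω₂ : Finset B) (f₁ : L → ℝ) (f₂ : B → ℝ) (a : L) (x : B) :
    productFun Ω₂ f₁ f₂ (extendLamps Ω₂ (fun _ => a) x) = f₁ a ^ Ω₂.card * f₂ x := by
  classical
  rw [productFun, if_pos fun y hy => by simp [extendLamps, hy], ← Finset.prod_const]
  congr 1
  exact Finset.prod_congr rfl fun y hy => by simp [extendLamps, hy]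

lemma exists_ne_zero_of_sqNorm_eq_one {α : Type*} {f : α → ℝ} (hf : sqNorm f = 1) :
    ∃ x, f x ≠ 0 := by
  by_contra! h
  simp [sqNorm, h] at hf

/-- The upper bound from the product test function. No normalisation of that function is needed,
since only its Rayleigh quotient matters. -/
theorem spectralProfile_switchOrWalk_le (μ₁ : PMF L) (μ₂ : PMF B) {c : ℝ≥0∞} {n₁ n₂ : ℕ}
    {v : ℝ≥0} (h₁ : spectralProfile μ₁ n₁ < c) (h₂ : spectralProfile μ₂ n₂ < c) (hn₁ : 1 ≤ n₁)
    (hv : ((n₁ ^ n₂ * n₂ : ℕ) : ℝ≥0) ≤ v) :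
    spectralProfile (switchOrWalk μ₁ μ₂) v ≤ c := by
  simp only [spectralProfile, dirichletEigenvalue, iInf_lt_iff] at h₁ h₂
  obtain ⟨Ω₁, hΩ₁, f₁, hf₁, hN₁, hE₁⟩ := h₁
  obtain ⟨Ω₂, hΩ₂, f₂, hf₂, hN₂, hE₂⟩ := h₂
  obtain ⟨Ω, hΩ, hcard⟩ := exists_support_productFun hf₁ hf₂
  obtain ⟨a, ha⟩ := exists_ne_zero_of_sqNorm_eq_one hN₁
  obtain ⟨x, hx⟩ := exists_ne_zero_of_sqNorm_eq_one hN₂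
  set f := productFun Ω₂ f₁ f₂ with hf
  have hf0 : sqNorm f ≠ 0 := by
    refine sqNorm_ne_zero (x := extendLamps Ω₂ (fun _ => a) x) ?_
    rw [hf, productFun_extendLamps_const]
    exact mul_ne_zero (pow_ne_zero _ ha) hx
  have hft : sqNorm f ≠ ∞ := by
    rw [sqNorm_eq_sum hΩ]
    exact ENNReal.ofReal_ne_top
  have hΩ₁' : Ω₁.card ≤ n₁ := by exact_mod_cast hΩ₁
  have hΩ₂' : Ω₂.card ≤ n₂ := by exact_mod_cast hΩ₂
  have hΩv : (Ω.card : ℝ≥0) ≤ v := by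
    refine le_trans ?_ hv
    have : Ω.card ≤ n₁ ^ n₂ * n₂ := hcard.trans <| by
      gcongr
    exact_mod_cast this
  have key := spectralProfile_mul_sqNorm_le (switchOrWalk μ₁ μ₂) hΩ hΩv
  rw [switchOrWalk, dirichletForm_halfSum,
    dirichletForm_map_of_cosets lampHom_injective μ₁ hN₁ (productFun_lamp_coset hf₂),
    dirichletForm_map_of_cosets baseHom_injective μ₂ hN₂ (productFun_base_coset Ω₂ f₁ f₂),
    ← hf, ← add_mul, ENNReal.mul_div_right_comm, ENNReal.mul_le_mul_iff_left hf0 hft] at key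
  refine key.trans (ENNReal.div_le_of_le_mul ?_)
  rw [mul_two]
  exact add_le_add hE₁.le hE₂.le

/-! ### The lower bound -/

/-- A function restricted to a coset has no larger support, so each factor alone bounds the profile
of the wreath product from below. -/
lemma spectralProfile_div_two_le_switchOrWalk (μ₁ : PMF L) (μ₂ : PMF B) (v : ℝ≥0) :
    spectralProfile μ₁ v / 2 ≤ spectralProfile (switchOrWalk μ₁ μ₂) v ∧
      spectralProfile μ₂ v / 2 ≤ spectralProfile (switchOrWalk μ₁ μ₂) v := by
  constructor <;>
    refine le_iInf₂ fun Ω hΩ => le_iInf₂ fun f hf => le_iInf fun (hN : sqNorm f = 1) => ?_ <;>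
    rw [switchOrWalk, dirichletForm_halfSum] <;> gcongr
  · have := spectralProfile_mul_sqNorm_le_map lampHom_injective μ₁ hf hΩ
    rw [hN, mul_one] at this
    exact this.trans le_self_add
  · have := spectralProfile_mul_sqNorm_le_map baseHom_injective μ₂ hf hΩ
    rw [hN, mul_one] at this
    exact this.trans le_add_self

open Classical in
/-- A nonempty finite set that holds at least `m` points of each lamp coset and `d` points of each
base coset it meets has at least `m ^ d` points. -/
lemma pow_le_card_of_cosets (m d : ℕ) {S : Finset (wreathProduct L B)} (hS : S.Nonempty)
    (hl : ∀ z₀ ∈ S, m ≤ (S.filter fun z : wreathProduct L B =>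
      (z : wreathProduct L B ⧸ (lampHom L B).range) = z₀).card)
    (hb : ∀ z₀ ∈ S, d ≤ (S.filter fun z : wreathProduct L B =>
      (z : wreathProduct L B ⧸ (baseHom L B).range) = z₀).card) :
    m ^ d ≤ S.card := by
  refine le_trans (pow_le_card_of_directions m d (S.image fun z => z.1.left) (hS.image _) ?_)
    Finset.card_image_le
  intro η hη
  obtain ⟨z₀, hz₀, rfl⟩ := Finset.mem_image.1 hη
  refine ⟨(S.filter fun z : wreathProduct L B =>
    (z : wreathProduct L B ⧸ (baseHom L B).range) = z₀).image fun z => z.1.right, ?_, ?_⟩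
  · rw [Finset.card_image_of_injOn]
    · exact hb z₀ hz₀
    · intro z hz z' hz' he
      obtain ⟨y, rfl⟩ := mk_eq_iff_exists.1 (Finset.mem_filter.1 hz).2
      obtain ⟨y', rfl⟩ := mk_eq_iff_exists.1 (Finset.mem_filter.1 hz').2
      exact wreath_ext (by rw [mul_baseHom_left, mul_baseHom_left]) he
  · intro x hx
    obtain ⟨z₁, hz₁, rfl⟩ := Finset.mem_image.1 hx
    obtain ⟨hz₁S, hz₁c⟩ := Finset.mem_filter.1 hz₁
    obtain ⟨y, rfl⟩ := mk_eq_iff_exists.1 hz₁c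
    refine (hl _ hz₁S).trans (Finset.card_le_card_of_injOn (fun z => z.1.left) ?_ ?_)
    · intro z hz
      obtain ⟨hzS, hzc⟩ := Finset.mem_filter.1 hz
      obtain ⟨h, rfl⟩ := mk_eq_iff_exists.1 hzc
      refine Finset.mem_filter.2 ⟨Finset.mem_image_of_mem _ hzS, fun y' hy' => ?_⟩
      exact (mul_lampHom_left_of_ne _ _ hy').trans (congrFun (mul_baseHom_left _ _) y')
    · intro z hz z' hz' he
      obtain ⟨h, rfl⟩ := mk_eq_iff_exists.1 (Finset.mem_filter.1 hz).2
      obtain ⟨h', rfl⟩ := mk_eq_iff_exists.1 (Finset.mem_filter.1 hz').2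
      exact wreath_ext he (by rw [mul_lampHom_right, mul_lampHom_right])

/-- A normalised function of energy below `s / 2500` has a support with at least
`(n₁ / 2 + 1) ^ (n₂ / 20 + 1)` points (integer divisions), if the profiles of the lamp group and
of the base group exceed `s` below the volumes `n₁` and `n₂`. -/
theorem pow_le_card_of_dirichletForm_lt (μ₁ : PMF L) (μ₂ : PMF B) {s : ℝ≥0} (hs : 0 < s)
    {n₁ n₂ : ℕ} (hn₁ : 1 ≤ n₁) (hn₂ : 1 ≤ n₂)
    (gap₁ : ∀ k : ℕ, k < n₁ → (s : ℝ≥0∞) < spectralProfile μ₁ k)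
    (gap₂ : ∀ k : ℕ, k < n₂ → (s : ℝ≥0∞) < spectralProfile μ₂ k)
    {Ω : Finset (wreathProduct L B)} {f : wreathProduct L B → ℝ}
    (hf : Function.support f ⊆ (Ω : Set _)) (hN : sqNorm f = 1)
    (hE : dirichletForm (switchOrWalk μ₁ μ₂) f < (s : ℝ≥0∞) / (2500 : ℝ≥0)) :
    (n₁ / 2 + 1) ^ (n₂ / 20 + 1) ≤ Ω.card := by
  classical
  -- pass from `Ω` to the exact support, on which `f ^ 2` is positive
  set A := Ω.filter fun z => f z ≠ 0 with hA
  have hfA : Function.support f ⊆ (A : Set _) := fun z hz =>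
    Finset.mem_coe.2 (Finset.mem_filter.2 ⟨hf hz, hz⟩)
  have hA1 : ∑ z ∈ A, f z ^ 2 = 1 := by
    rw [sqNorm_eq_sum hfA, ENNReal.ofReal_eq_one] at hN
    exact hN
  set ε : ℝ≥0 := 1 / 100 with hε
  set G₁ := lowEnergyCosets (lampHom L B) μ₁ f (ε * s) with hG₁
  set G₂ := lowEnergyCosets (baseHom L B) μ₂ f (ε * s) with hG₂
  have hsum : dirichletForm (μ₁.map (lampHom L B)) f + dirichletForm (μ₂.map (baseHom L B)) f ≤
      (s * (2 / 2500) : ℝ≥0) := by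
    rw [switchOrWalk, dirichletForm_halfSum] at hE
    have h1 := (ENNReal.div_le_iff two_ne_zero ENNReal.ofNat_ne_top).1 hE.le
    refine h1.trans (le_of_eq ?_)
    rw [← ENNReal.coe_div (by norm_num), show (2 : ℝ≥0∞) = (2 : ℝ≥0) by norm_cast,
      ← ENNReal.coe_mul]
    congr 1
    ring
  -- Markov's inequality in real form
  have markov : ∀ {t : ℝ} {E : ℝ≥0∞}, 0 ≤ t → (ε * s : ℝ≥0∞) * ENNReal.ofReal t ≤ E →
      E ≤ (s * (2 / 2500) : ℝ≥0) → t ≤ 2 / 25 := by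
    intro t E ht h1 h2
    have h3 := h1.trans h2
    rw [← ENNReal.coe_mul, ← ENNReal.ofReal_coe_nnreal, ← ENNReal.ofReal_coe_nnreal,
      ← ENNReal.ofReal_mul (NNReal.coe_nonneg _), ENNReal.ofReal_le_ofReal_iff (by positivity)] at h3
    have hs' : (0 : ℝ) < s := by exact_mod_cast hs
    have : (s : ℝ) * (t / 100) ≤ s * (2 / 2500) := by
      simp only [hε] at h3
      push_cast at h3
      linarith
    have := le_of_mul_le_mul_left this hs'
    linarith
  have hbad₁ := markov (Finset.sum_nonneg fun _ _ => sq_nonneg _)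
    (mul_sum_sq_not_lowEnergy_le lampHom_injective μ₁ f (ε * s) A) (le_self_add.trans hsum)
  have hbad₂ := markov (Finset.sum_nonneg fun _ _ => sq_nonneg _)
    (mul_sum_sq_not_lowEnergy_le baseHom_injective μ₂ f (ε * s) A) (le_add_self.trans hsum)
  set G := A.filter fun z : wreathProduct L B =>
    (z : wreathProduct L B ⧸ (lampHom L B).range) ∈ G₁ ∧
    (z : wreathProduct L B ⧸ (baseHom L B).range) ∈ G₂ with hG
  have hbad : 6 * ∑ z ∈ A \ G, f z ^ 2 < ∑ z ∈ A, f z ^ 2 := by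
    have h1 : ∑ z ∈ A \ G, f z ^ 2 ≤ 2 / 25 + 2 / 25 := by
      refine le_trans ?_ (add_le_add hbad₁ hbad₂)
      refine le_trans (Finset.sum_le_sum_of_subset_of_nonneg (t := A.filter
          (fun z : wreathProduct L B => (z : wreathProduct L B ⧸ (lampHom L B).range) ∉ G₁) ∪
        A.filter
          (fun z : wreathProduct L B => (z : wreathProduct L B ⧸ (baseHom L B).range) ∉ G₂))
        ?_ fun _ _ _ => sq_nonneg _) ?_
      · intro z hz
        simp only [hG, Finset.mem_sdiff, Finset.mem_filter, Finset.mem_union] at hz ⊢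
        tauto
      · rw [← Finset.sum_union_inter]
        exact le_add_of_nonneg_right (Finset.sum_nonneg fun _ _ => sq_nonneg _)
    rw [hA1]
    linarith
  obtain ⟨S, hSG, hSne, hS⟩ := exists_pruned (Finset.filter_subset _ _ : G ⊆ A)
    (m := fun z => f z ^ 2) (fun z => sq_nonneg _)
    (fun z : wreathProduct L B => (z : wreathProduct L B ⧸ (baseHom L B).range))
    (fun z : wreathProduct L B => (z : wreathProduct L B ⧸ (lampHom L B).range)) (by convert hbad)
  have hSA : S ⊆ A := hSG.trans (Finset.filter_subset _ _)
  have hεR : (ε : ℝ) = 1 / 100 := by simp [hε]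
  refine (pow_le_card_of_cosets (n₁ / 2 + 1) (n₂ / 20 + 1) hSne ?_ ?_).trans
    (Finset.card_le_card (hSA.trans (Finset.filter_subset _ _)))
  -- `2 / 3 - 11 / 100 > 11 / 20`, which gives more than `n₁ / 2` points
  · intro z₀ hz₀
    have h2 : 2 * ∑ z ∈ A.filter (fun z : wreathProduct L B =>
          (z : wreathProduct L B ⧸ (lampHom L B).range) = z₀), f z ^ 2 ≤
        3 * ∑ z ∈ S.filter (fun z : wreathProduct L B =>
          (z : wreathProduct L B ⧸ (lampHom L B).range) = z₀), f z ^ 2 := by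
      convert (hS z₀ hz₀).2
    have h3 := mul_le_card_of_share lampHom_injective hs hn₁ gap₁ hfA hSA
      (Finset.mem_filter.1 (hSA hz₀)).2 (Finset.mem_filter.1 (hSG hz₀)).2.1
      (θ := 1 / 10) (κ := 2 / 3) (by norm_num) (by linarith)
    rw [hεR] at h3
    have hn : (0 : ℝ) < n₁ := by exact_mod_cast hn₁
    have h4 : (n₁ : ℝ) < 2 * (S.filter fun z : wreathProduct L B =>
        (z : wreathProduct L B ⧸ (lampHom L B).range) = z₀).card := by
      norm_num at h3
      linarith
    have h5 : n₁ < 2 * (S.filter fun z : wreathProduct L B =>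
        (z : wreathProduct L B ⧸ (lampHom L B).range) = z₀).card := by
      exact_mod_cast h4
    omega
  -- `1 / 6 - 2 / 100 > 2 / 20`, which gives more than `n₂ / 20` points
  · intro z₀ hz₀
    have h2 : ∑ z ∈ A.filter (fun z : wreathProduct L B =>
          (z : wreathProduct L B ⧸ (baseHom L B).range) = z₀), f z ^ 2 ≤
        6 * ∑ z ∈ S.filter (fun z : wreathProduct L B =>
          (z : wreathProduct L B ⧸ (baseHom L B).range) = z₀), f z ^ 2 := by
      convert (hS z₀ hz₀).1
    have h3 := mul_le_card_of_share baseHom_injective hs hn₂ gap₂ hfA hSA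
      (Finset.mem_filter.1 (hSA hz₀)).2 (Finset.mem_filter.1 (hSG hz₀)).2.2
      (θ := 1) (κ := 1 / 6) (by norm_num) (by linarith)
    rw [hεR] at h3
    have hn : (0 : ℝ) < n₂ := by exact_mod_cast hn₂
    have h4 : (n₂ : ℝ) < 20 * (S.filter fun z : wreathProduct L B =>
        (z : wreathProduct L B ⧸ (baseHom L B).range) = z₀).card := by
      norm_num at h3
      linarith
    have h5 : n₂ < 20 * (S.filter fun z : wreathProduct L B =>
        (z : wreathProduct L B ⧸ (baseHom L B).range) = z₀).card := by
      exact_mod_cast h4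
    omega

lemma extPow_natCast (n : ℕ) (b : ℝ≥0∞) (hb : b ≠ ∞) : extPow n b = (n : ℝ≥0∞) ^ b.toReal :=
  if_neg hb

/-- The lower bound for the cardinality of the support exceeds the power in the hypothesis on `v`,
since `(n₁ / 2 + 1) ^ 2 ≥ n₁` and `2 / 2500 < 1 / 20`. -/
lemma rpow_lt_pow {n₁ n₂ : ℕ} (hn₁ : 2 ≤ n₁) :
    (n₁ : ℝ) ^ ((n₂ : ℝ) / 2500) < ((n₁ / 2 + 1) ^ (n₂ / 20 + 1) : ℕ) := by
  set m := n₁ / 2 + 1 with hm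
  set d := n₂ / 20 + 1 with hd
  have hm2 : n₁ ≤ m ^ 2 := by
    have h1 : n₁ < 2 * m := by omega
    have h2 : 2 ≤ m := by omega
    nlinarith
  have hm1 : (1 : ℝ) < m := by
    have : 1 < m := by omega
    exact_mod_cast this
  have hd20 : (n₂ : ℝ) < 20 * d := by
    have : n₂ < 20 * d := by omega
    exact_mod_cast this
  calc (n₁ : ℝ) ^ ((n₂ : ℝ) / 2500) ≤ ((m : ℝ) ^ (2 : ℝ)) ^ ((n₂ : ℝ) / 2500) := by
        refine Real.rpow_le_rpow (by positivity) ?_ (by positivity)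
        exact_mod_cast hm2
    _ = (m : ℝ) ^ (2 * ((n₂ : ℝ) / 2500)) := (Real.rpow_mul (by positivity) _ _).symm
    _ < (m : ℝ) ^ (d : ℝ) := by
        refine Real.rpow_lt_rpow_of_exponent_lt hm1 ?_
        linarith
    _ = (m ^ d : ℕ) := by rw [Real.rpow_natCast]; push_cast; rfl

theorem div_le_spectralProfile_switchOrWalk (μ₁ : PMF L) (μ₂ : PMF B) {s v : ℝ≥0} (hs : 0 < s)
    (hmax : (s : ℝ≥0∞) ≤ spectralProfile μ₁ 1 ∨ (s : ℝ≥0∞) ≤ spectralProfile μ₂ 1)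
    (hv : (v : ℝ≥0∞) ≤ extPow (spectralProfileInv μ₁ s)
      (spectralProfileInv μ₂ s / ((2500 : ℝ≥0) : ℝ≥0∞))) :
    (s : ℝ≥0∞) / ((2500 : ℝ≥0) : ℝ≥0∞) ≤ spectralProfile (switchOrWalk μ₁ μ₂) v := by
  have half : (s : ℝ≥0∞) / ((2500 : ℝ≥0) : ℝ≥0∞) ≤ s / 2 := by
    gcongr
    norm_num
  have hhalf := spectralProfile_div_two_le_switchOrWalk μ₁ μ₂ v
  by_cases h₁ : spectralProfileInv μ₁ s = ∞
  · exact half.trans (le_trans (by gcongr; exact (lt_spectralProfile_of_inv_eq_top h₁ v).le)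
      hhalf.1)
  by_cases h₂ : spectralProfileInv μ₂ s = ∞
  · exact half.trans (le_trans (by gcongr; exact (lt_spectralProfile_of_inv_eq_top h₂ v).le)
      hhalf.2)
  obtain ⟨n₁, hn₁, e₁, -, gap₁⟩ := exists_nat_eq_spectralProfileInv h₁
  obtain ⟨n₂, hn₂, e₂, -, gap₂⟩ := exists_nat_eq_spectralProfileInv h₂
  have hexp : (n₂ : ℝ≥0∞) / ((2500 : ℝ≥0) : ℝ≥0∞) = ((n₂ / 2500 : ℝ≥0) : ℝ≥0∞) := by
    rw [ENNReal.coe_div (by norm_num)]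
    rfl
  rw [e₁, e₂, hexp, extPow_natCast _ _ ENNReal.coe_ne_top, ENNReal.coe_toReal] at hv
  have hvr : (v : ℝ) ≤ (n₁ : ℝ) ^ ((n₂ : ℝ) / 2500) := by
    have : (n₁ : ℝ≥0∞) = ((n₁ : ℝ≥0) : ℝ≥0∞) := rfl
    rw [this, ← ENNReal.coe_rpow_of_nonneg _ (NNReal.coe_nonneg _), ENNReal.coe_le_coe] at hv
    have := NNReal.coe_le_coe.2 hv
    push_cast at this
    exact this
  rcases hn₁.eq_or_lt with rfl | hn₁'
  · -- here `v ≤ 1`, and the bound on `s` enters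
    have hv1 : v ≤ 1 := by
      rw [Nat.cast_one, Real.one_rpow] at hvr
      exact_mod_cast hvr
    rcases hmax with h | h
    · refine half.trans (le_trans ?_ hhalf.1)
      gcongr
      exact h.trans (spectralProfile_antitone μ₁ hv1)
    · refine half.trans (le_trans ?_ hhalf.2)
      gcongr
      exact h.trans (spectralProfile_antitone μ₂ hv1)
  · refine le_iInf₂ fun Ω hΩ => le_iInf₂ fun f hf => le_iInf fun (hN : sqNorm f = 1) => ?_
    by_contra! hE
    have h1 := pow_le_card_of_dirichletForm_lt μ₁ μ₂ hs hn₁ hn₂ gap₁ gap₂ hf hN hE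
    have h2 := hvr.trans_lt (rpow_lt_pow (n₂ := n₂) hn₁')
    have h3 : (Ω.card : ℝ) ≤ v := by exact_mod_cast hΩ
    have h4 := h3.trans_lt h2
    exact absurd h1 (not_le.2 (by exact_mod_cast h4))

end Wreath

theorem spectralProfile_switchOrWalk_le_of_extPow {L B : Type*} [Group L] [Group B]
    (μ₁ : PMF L) (μ₂ : PMF B) {s v : ℝ≥0}
    (hv : extPow (spectralProfileInv μ₁ s) (spectralProfileInv μ₂ s) * spectralProfileInv μ₂ s
      ≤ (v : ℝ≥0∞)) :
    spectralProfile (switchOrWalk μ₁ μ₂) v ≤ (s : ℝ≥0∞) := by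
  -- an infinite value of either inverse makes the left side of `hv` infinite
  by_cases h₂ : spectralProfileInv μ₂ s = ∞
  · have h1 := one_le_spectralProfileInv μ₁ s
    have h0 : extPow (spectralProfileInv μ₁ s) ∞ ≠ 0 := by
      rw [extPow, if_pos rfl, if_neg (not_lt.2 h1)]
      split_ifs <;> simp
    rw [h₂, ENNReal.mul_top h0] at hv
    exact absurd (top_le_iff.1 hv) ENNReal.coe_ne_top
  obtain ⟨n₂, hn₂, e₂, l₂, -⟩ := exists_nat_eq_spectralProfileInv h₂
  have hn₂' : (n₂ : ℝ≥0∞) ≠ 0 := by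
    have : n₂ ≠ 0 := by omega
    exact_mod_cast this
  rw [e₂, extPow, if_neg (ENNReal.natCast_ne_top n₂), ENNReal.toReal_natCast,
    ENNReal.rpow_natCast] at hv
  by_cases h₁ : spectralProfileInv μ₁ s = ∞
  · rw [h₁, ENNReal.top_pow (by omega), ENNReal.top_mul hn₂'] at hv
    exact absurd (top_le_iff.1 hv) ENNReal.coe_ne_top
  obtain ⟨n₁, hn₁, e₁, l₁, -⟩ := exists_nat_eq_spectralProfileInv h₁
  rw [e₁] at hv
  -- the infima in the profiles of the factors need not be attained
  exact le_of_forall_gt_imp_ge_of_dense fun c hc =>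
    spectralProfile_switchOrWalk_le μ₁ μ₂ (l₁.trans_lt hc) (l₂.trans_lt hc) hn₁
      (by exact_mod_cast hv)

end WreathProfile

theorem mainTheorem1 :
    (∃ K : ℝ≥0, 0 < K ∧
      ∀ (H₁ : Type u) (H₂ : Type w) [Group H₁] [Group H₂] [Group.FG H₁] [Group.FG H₂]
        (μ₁ : PMF H₁) (μ₂ : PMF H₂), IsSymmetricPMF μ₁ → IsSymmetricPMF μ₂ →
        ∀ s v : ℝ≥0, 0 < s → 0 < v →
          ((s : ℝ≥0∞) ≤ spectralProfile μ₁ 1 ∨ (s : ℝ≥0∞) ≤ spectralProfile μ₂ 1) →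
          (v : ℝ≥0∞) ≤ extPow (spectralProfileInv μ₁ s) (spectralProfileInv μ₂ s / (K : ℝ≥0∞)) →
          (s : ℝ≥0∞) / (K : ℝ≥0∞) ≤ spectralProfile (switchOrWalk μ₁ μ₂) v) ∧
    (∀ (H₁ : Type u) (H₂ : Type w) [Group H₁] [Group H₂] [Group.FG H₁] [Group.FG H₂]
        (μ₁ : PMF H₁) (μ₂ : PMF H₂), IsSymmetricPMF μ₁ → IsSymmetricPMF μ₂ →
        ∀ s v : ℝ≥0, 0 < s → 0 < v →
          extPow (spectralProfileInv μ₁ s) (spectralProfileInv μ₂ s) * spectralProfileInv μ₂ s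
            ≤ (v : ℝ≥0∞) →
          spectralProfile (switchOrWalk μ₁ μ₂) v ≤ (s : ℝ≥0∞)) := by
  refine ⟨⟨2500, by norm_num, ?_⟩, ?_⟩
  · intro H₁ H₂ _ _ _ _ μ₁ μ₂ _ _ s v hs _ hmax hv
    exact div_le_spectralProfile_switchOrWalk μ₁ μ₂ hs hmax hv
  · intro H₁ H₂ _ _ _ _ μ₁ μ₂ _ _ s v _ _ hv
    exact spectralProfile_switchOrWalk_le_of_extPow μ₁ μ₂ hv
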